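/- Theorem 4.3. Let $p\in(0,1]$ and let $(A,\|\cdot\|)$ be a complex $p$-Banach algebra with unit, that is, a unital associative complex algebra, complete for a norm-like function $\|\cdot\|:A\to[0,\infty)$ such that $\|a\|=0$ only for $a=0$, $\|a+b\|\le\|a\|+\|b\|$, $\|\lambda a\|=|\lambda|^p\|a\|$ and $\|ab\|\le\|a\|\,\|b\|$ for all $a,b\in A$, $\lambda\in\mathbb C$. Suppose there is a constant $m>0$ with $\|a\|^2\le m\|a^2\|$ for all $a\in A$. Let $$|a|=\inf\Big\{\sum_{i=1}^n\|a_i\|^{1/p} : n\ge 1,\ a_1,\dots,a_n\in A,\ a=\sum_{i=1}^n a_i\Big\}$$ be the support seminorm of $\|\cdot\|$, and let $M(A)$ be the set of nonzero continuous multiplicative linear functionals $f:A\to\mathbb C$ with the topology of pointwise convergence on $A$. Then $M(A)$ is compact, and the Gelfand map $G:A\to C(M(A))$, $G(a)(f)=f(a)$, is an injective algebra homomorphism such that, for all $a\in A$, $$m^{-2/p}\|a\|^{1/p}\le m^{-1/p}|a|\le\|G(a)\|_s\le|a|\le\|a\|^{1/p},$$ where $\|\cdot\|_s$ is the supremum norm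 on $C(M(A))$. -/

import Mathlib

/-- The support seminorm `|a|` of a `p`-homogeneous (semi)norm `‖·‖`: the infimum of
`∑ i, ‖a_i‖ ^ (1 / p)` over all finite decompositions `a = ∑ i, a_i` (with at least one term). -/
noncomputable def supportSeminorm {A : Type*} [SeminormedRing A] (p : ℝ) (a : A) : ℝ :=
  sInf {s : ℝ | ∃ (n : ℕ) (x : Fin n → A),
    1 ≤ n ∧ a = ∑ i, x i ∧ s = ∑ i, ‖x i‖ ^ (1 / p)}

open Filter Topology Finset

/-! Everything rests on iterating the square inequality to `m * ‖a‖ ^ N ≤ m ^ N * ‖a ^ N‖` for `N =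
2 ^ n`: after `N`-th roots, constants and polynomial factors in `N` vanish.

Commutativity follows Le Page's argument. By `norm_conj_le`, `exp (z a) * b * exp (-z a)` is bounded
by `m * ‖b‖` for all `z`, so Liouville makes it constant, and its linear coefficient is the
commutator. As `A` need not be locally convex, Liouville is proved by averaging over roots of unity
(`coeff_eq_zero_of_bounded`).

For commutative `A`, the multinomial expansion of `(∑ x i) ^ N` gives `‖a‖ ≤ m * |a| ^ p`. So the
support seminorm is an equivalent Banach algebra norm, and Gelfand theory applies to it. The same
iterated inequality bounds the spectral radius below by `(‖a‖ / m) ^ (1 / p)`. -/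

/-- A comparison of the powers along `2 ^ n`, up to a polynomial factor, descends to the bases. -/
theorem le_of_forall_pow_two_pow_le {s t C : ℝ} (K : ℕ) (ht : 0 ≤ t)
    (h : ∀ n : ℕ, s ^ (2 ^ n) ≤ C * ((2 ^ n : ℕ) + 1 : ℝ) ^ K * t ^ (2 ^ n)) : s ≤ t := by
  by_contra! hst
  have hs : 0 < s := ht.trans_lt hst
  -- Unlike `t`, the intermediate `t'` is positive, so the ratio `s / t'` is usable.
  obtain ⟨t', htt', ht's⟩ := exists_between hst
  have ht' : 0 < t' := ht.trans_lt htt'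
  have hr : 1 < s / t' := (one_lt_div ht').2 ht's
  have h1 : Tendsto (fun n : ℕ => ((n : ℝ) + 1) ^ K / (s / t') ^ n) atTop (𝓝 0) := by
    have := ((tendsto_pow_const_div_const_pow_of_one_lt K hr).comp
      (tendsto_add_atTop_nat 1)).const_mul (s / t')
    rw [mul_zero] at this
    refine this.congr fun n => ?_
    simp only [Function.comp, Nat.cast_add, Nat.cast_one]
    have : (s / t') ^ n ≠ 0 := by positivity
    rw [pow_succ]
    field_simp
  have h2 := (h1.const_mul |C|).comp (tendsto_pow_atTop_atTop_of_one_lt (one_lt_two (α := ℕ)))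
  rw [mul_zero] at h2
  obtain ⟨n, hn⟩ := (h2.eventually (gt_mem_nhds one_pos)).exists
  simp only [Function.comp] at hn
  have hpos : 0 < (s / t') ^ (2 ^ n) := by positivity
  rw [← mul_div_assoc, div_lt_one hpos, div_pow, lt_div_iff₀ (by positivity)] at hn
  have h3 : C * ((2 ^ n : ℕ) + 1 : ℝ) ^ K * t ^ (2 ^ n)
      ≤ |C| * ((2 ^ n : ℕ) + 1 : ℝ) ^ K * t' ^ (2 ^ n) := by
    gcongr
    exact le_abs_self C
  exact absurd ((h n).trans h3) (not_le.2 hn)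

/-! ### Consequences of the square inequality. -/

section SquareBound

variable {A : Type*} [NormedRing A] {m : ℝ}

theorem norm_pow_two_pow_le (hm : 0 < m) (hsq : ∀ a : A, ‖a‖ ^ 2 ≤ m * ‖a ^ 2‖) (a : A) (n : ℕ) :
    m * ‖a‖ ^ (2 ^ n) ≤ m ^ (2 ^ n) * ‖a ^ (2 ^ n)‖ := by
  induction n with
  | zero => simp
  | succ n ih =>
    have h1 := pow_le_pow_left₀ (by positivity) ih 2
    have h2 := mul_le_mul_of_nonneg_left (hsq (a ^ (2 ^ n))) (by positivity : 0 ≤ (m ^ (2 ^ n)) ^ 2)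
    rw [pow_succ 2 n, pow_mul, pow_mul, pow_mul]
    refine le_of_mul_le_mul_left ?_ hm
    calc m * (m * (‖a‖ ^ 2 ^ n) ^ 2) = (m * ‖a‖ ^ 2 ^ n) ^ 2 := by ring
      _ ≤ (m ^ 2 ^ n) ^ 2 * ‖a ^ 2 ^ n‖ ^ 2 := by rw [← mul_pow]; exact h1
      _ ≤ _ := h2
      _ = _ := by ring

theorem norm_pow_le_one_add_norm_one_mul (x : A) (n : ℕ) :
    ‖x ^ n‖ ≤ (1 + ‖(1 : A)‖) * ‖x‖ ^ n := by
  rcases n.eq_zero_or_pos with rfl | hn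
  · simp
  · exact (norm_pow_le' x hn).trans (le_mul_of_one_le_left (by positivity)
      (by linarith [norm_nonneg (1 : A)]))

/-- Since `v * u = 1`, powers telescope to `u * b ^ N * v`, so `‖u‖` and `‖v‖` enter only once and
disappear after `N`-th roots. -/
theorem norm_conj_le (hm : 0 < m) (hsq : ∀ a : A, ‖a‖ ^ 2 ≤ m * ‖a ^ 2‖) {u v : A}
    (h : v * u = 1) (b : A) : ‖u * b * v‖ ≤ m * ‖b‖ := by
  refine le_of_forall_pow_two_pow_le (C := ‖u‖ * (1 + ‖(1 : A)‖) * ‖v‖ / m) 0 (by positivity)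
    fun n => ?_
  have hpow : ∀ k : ℕ, (u * b * v) ^ (k + 1) = u * b ^ (k + 1) * v := by
    intro k
    induction k with
    | zero => simp
    | succ k ih =>
      rw [pow_succ, ih, pow_succ b (k + 1)]
      calc u * b ^ (k + 1) * v * (u * b * v) = u * b ^ (k + 1) * (v * u) * b * v := by
            simp only [mul_assoc]
        _ = _ := by rw [h]; simp only [mul_assoc, mul_one]
  obtain ⟨k, hk⟩ : ∃ k, 2 ^ n = k + 1 := Nat.exists_eq_succ_of_ne_zero (by positivity)
  have h1 := norm_pow_two_pow_le hm hsq (u * b * v) n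
  have h2 : ‖(u * b * v) ^ (2 ^ n)‖ ≤ ‖u‖ * ((1 + ‖(1 : A)‖) * ‖b‖ ^ (2 ^ n)) * ‖v‖ := by
    rw [hk, hpow]
    refine (norm_mul_le _ _).trans ?_
    gcongr
    refine (norm_mul_le _ _).trans ?_
    gcongr
    exact norm_pow_le_one_add_norm_one_mul b _
  rw [pow_zero, mul_one, div_mul_eq_mul_div, le_div_iff₀ hm, mul_comm]
  refine h1.trans ((mul_le_mul_of_nonneg_left h2 (by positivity)).trans_eq ?_)
  rw [mul_pow]
  ring

end SquareBound

/-! ### Liouville's theorem without local convexity. -/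

section Liouville

variable {V : Type*} [NormedAddCommGroup V] [Module ℂ V] {p : ℝ}

theorem continuousConstSMul_of_norm_smul (hhom : ∀ (c : ℂ) (a : V), ‖c • a‖ = ‖c‖ ^ p * ‖a‖) :
    ContinuousConstSMul ℂ V := by
  refine ⟨fun c => LipschitzWith.continuous (K := (‖c‖ ^ p).toNNReal)
    (LipschitzWith.of_dist_le_mul fun x y => ?_)⟩
  rw [dist_eq_norm, dist_eq_norm, ← smul_sub, hhom, Real.coe_toNNReal _ (by positivity)]

/-- The exponent `n + (N - k)` stands for `n - k` modulo `N`; it lies strictly between `0` and `2 *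
N`, so `N` divides it only when `n = k`. -/
theorem IsPrimitiveRoot.avg_eq_ite {N : ℕ} (hN : 0 < N) {ω : ℂ} (hω : IsPrimitiveRoot ω N)
    {k n : ℕ} (hk : k < N) (hn : n < N) :
    (N : ℂ)⁻¹ * ∑ j ∈ range N, (ω ^ (n + (N - k))) ^ j = if n = k then 1 else 0 := by
  have hN' : (N : ℂ) ≠ 0 := by exact_mod_cast hN.ne'
  split_ifs with h
  · subst h
    rw [Nat.add_sub_cancel' hk.le, hω.pow_eq_one]
    simp [hN']
  · have h1 : ω ^ (n + (N - k)) ≠ 1 := by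
      intro h1
      rw [hω.pow_eq_one_iff_dvd] at h1
      obtain ⟨c, hc⟩ := h1
      have : c = 1 := by
        rcases Nat.lt_trichotomy c 1 with h2 | h2 | h2
        · interval_cases c; omega
        · exact h2
        · have := Nat.mul_le_mul_left N h2
          omega
      subst this
      omega
    rw [geom_sum_eq h1, ← pow_mul, mul_comm _ N, pow_mul ω N, hω.pow_eq_one]
    simp

/-- Averaging a power series over the `N`-th roots of unity isolates a coefficient, up to the tail
of the series. -/
theorem norm_coeff_le_of_bounded (hp0 : 0 < p)
    (hhom : ∀ (c : ℂ) (a : V), ‖c • a‖ = ‖c‖ ^ p * ‖a‖) {c : ℕ → V} {f : ℂ → V} {M : ℝ}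
    (hf : ∀ z : ℂ, HasSum (fun n => z ^ n • c n) (f z)) (hM : ∀ z, ‖f z‖ ≤ M)
    {N k : ℕ} (hk : k < N) {r : ℝ} {g : ℕ → ℝ} (hg0 : ∀ n, 0 ≤ g n) (hg : Summable g)
    (htail : ∀ n, N ≤ n → ‖(r : ℂ) ^ n • c n‖ ≤ g n) :
    ‖(r : ℂ) ^ k • c k‖ ≤ N * M + ∑' n, g n := by
  have hN : 0 < N := by omega
  have hM0 : 0 ≤ M := (norm_nonneg _).trans (hM 0)
  have := continuousConstSMul_of_norm_smul hhom
  set ω : ℂ := Complex.exp (2 * Real.pi * Complex.I / N) with hωdef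
  have hω : IsPrimitiveRoot ω N := Complex.isPrimitiveRoot_exp N hN.ne'
  have hω1 : ‖ω‖ = 1 := hω.norm'_eq_one hN.ne'
  set w : ℕ → ℂ := fun n => (N : ℂ)⁻¹ * ∑ j ∈ range N, (ω ^ (n + (N - k))) ^ j with hw
  have hN1 : ‖(N : ℂ)⁻¹‖ ≤ 1 := by
    rw [norm_inv, Complex.norm_natCast]
    exact inv_le_one_of_one_le₀ (by exact_mod_cast hN)
  have hw1 : ∀ n, ‖w n‖ ≤ 1 := by
    intro n
    rw [hw]
    simp only [norm_mul, norm_inv, Complex.norm_natCast]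
    rw [inv_mul_le_iff₀ (by exact_mod_cast hN), mul_one]
    refine (norm_sum_le _ _).trans ?_
    simp [hω1]
  set S : V := ∑ j ∈ range N, ((N : ℂ)⁻¹ * ω ^ (j * (N - k))) • f (ω ^ j * r) with hS
  -- The weights only shrink norms by `N ^ (-p)`, so averaging `N` terms may lose a power of `N`;
  -- the crude factor `N` suffices.
  have hS1 : ‖S‖ ≤ N * M := by
    refine (norm_sum_le _ _).trans ?_
    refine (sum_le_card_nsmul _ _ M fun j _ => ?_).trans_eq (by simp)
    rw [hhom]
    refine (mul_le_of_le_one_left (norm_nonneg _) (Real.rpow_le_one (norm_nonneg _) ?_ hp0.le)).trans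
      (hM _)
    rw [norm_mul, norm_pow, hω1, one_pow, mul_one]
    exact hN1
  have hsum : HasSum (fun n => w n • ((r : ℂ) ^ n • c n)) S := by
    have := hasSum_sum (s := range N)
      fun j _ => (hf (ω ^ j * r)).const_smul ((N : ℂ)⁻¹ * ω ^ (j * (N - k)))
    refine this.congr_fun fun n => ?_
    simp only [hw, smul_smul, ← sum_smul]
    congr 1
    rw [mul_sum, sum_mul]
    refine sum_congr rfl fun j _ => ?_
    rw [mul_pow, ← pow_mul, ← pow_mul, add_mul, pow_add, mul_comm n j, mul_comm j (N - k)]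
    ring
  -- All terms of index below `N` cancel here, leaving the tail.
  have hdiff := hsum.sub (hasSum_ite_eq k ((r : ℂ) ^ k • c k))
  have hbound : ‖S - (r : ℂ) ^ k • c k‖ ≤ ∑' n, g n := by
    rw [← hdiff.tsum_eq]
    refine tsum_of_norm_bounded hg.hasSum fun n => ?_
    rcases lt_or_ge n N with h | h
    · rw [hw]
      simp only [hω.avg_eq_ite hN hk h]
      split_ifs with h'
      · subst h'; simpa using hg0 n
      · simpa using hg0 n
    · rw [if_neg (by omega), sub_zero, hhom]
      exact (mul_le_of_le_one_left (norm_nonneg _)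
        (Real.rpow_le_one (norm_nonneg _) (hw1 n) hp0.le)).trans (htail n h)
  calc ‖(r : ℂ) ^ k • c k‖ = ‖S - (S - (r : ℂ) ^ k • c k)‖ := by rw [sub_sub_cancel]
    _ ≤ ‖S‖ + ‖S - (r : ℂ) ^ k • c k‖ := norm_sub_le _ _
    _ ≤ _ := add_le_add hS1 hbound

theorem eq_zero_of_forall_nat_mul_le {s C : ℝ} (hs : 0 ≤ s) (k : ℕ)
    (h : ∀ N : ℕ, k < N → N * s ≤ C) : s = 0 := by
  by_contra hne
  have hpos : 0 < s := lt_of_le_of_ne hs (Ne.symm hne)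
  obtain ⟨N, hN⟩ := exists_nat_gt (C / s)
  rw [div_lt_iff₀ hpos] at hN
  have h1 := h (N + k + 1) (by omega)
  push_cast at h1
  nlinarith [(Nat.cast_nonneg k : (0 : ℝ) ≤ k)]

theorem half_pow_bound {N n : ℕ} (h : N ≤ n) :
    ((N : ℝ) / (2 * Real.exp 1)) ^ n / (n.factorial : ℝ) ≤ (1 / 2) ^ n := by
  have h1 : (n : ℝ) ^ n / n.factorial ≤ Real.exp n :=
    Real.pow_div_factorial_le_exp (x := n) (by positivity) n
  have h2 : Real.exp n = Real.exp 1 ^ n := by rw [← Real.exp_nat_mul, mul_one]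
  have hN : (N : ℝ) ≤ n := by exact_mod_cast h
  calc ((N : ℝ) / (2 * Real.exp 1)) ^ n / (n.factorial : ℝ)
      ≤ ((n : ℝ) / (2 * Real.exp 1)) ^ n / (n.factorial : ℝ) := by gcongr
    _ = (1 / 2) ^ n * ((n : ℝ) ^ n / n.factorial / Real.exp 1 ^ n) := by
        rw [div_pow, mul_pow, one_div, inv_pow]; field_simp
    _ ≤ (1 / 2) ^ n * 1 := by
        gcongr
        rw [div_le_one (by positivity), ← h2]
        exact h1
    _ = _ := mul_one _

theorem summable_rpow_half_pow (hp0 : 0 < p) : Summable fun n : ℕ => (((1 / 2 : ℝ)) ^ n) ^ p := by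
  have : (fun n : ℕ => (((1 / 2 : ℝ)) ^ n) ^ p) = fun n : ℕ => ((1 / 2 : ℝ) ^ p) ^ n := by
    funext n
    rw [Real.rpow_pow_comm (by norm_num)]
  rw [this]
  exact summable_geometric_of_lt_one (by positivity)
    (Real.rpow_lt_one (by norm_num) (by norm_num) hp0)

/-- **Liouville's theorem** for entire power series of finite order in a `p`-normed space. -/
theorem coeff_eq_zero_of_bounded (hp0 : 0 < p)
    (hhom : ∀ (c : ℂ) (a : V), ‖c • a‖ = ‖c‖ ^ p * ‖a‖) {c : ℕ → V} {f : ℂ → V} {M E R : ℝ}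
    (hf : ∀ z : ℂ, HasSum (fun n => z ^ n • c n) (f z)) (hM : ∀ z, ‖f z‖ ≤ M)
    (hR : 0 < R) (hE : 0 ≤ E)
    (hc : ∀ n, ‖c n‖ ≤ E * (R ^ n * ((n.factorial : ℝ)⁻¹) ^ p)) {k : ℕ} (hk : 1 ≤ k) :
    c k = 0 := by
  have hM0 : 0 ≤ M := (norm_nonneg _).trans (hM 0)
  obtain ⟨D, hD, hDR⟩ : ∃ D : ℝ, 0 < D ∧ D ^ p = R :=
    ⟨R ^ p⁻¹, by positivity, Real.rpow_inv_rpow hR.le hp0.ne'⟩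
  have norm_smul_pow : ∀ (r : ℝ) (n : ℕ) (v : V), 0 ≤ r →
      ‖(r : ℂ) ^ n • v‖ = (r ^ n) ^ p * ‖v‖ := by
    intro r n v hr
    rw [hhom, norm_pow, Complex.norm_real, Real.norm_of_nonneg hr]
  -- At radius `N / (2 e D)` the tail is bounded independently of `N`, while the `k`-th term carries
  -- `N ^ (p k) ≥ N ^ 2`, which beats the loss `N * M`.
  have hlarge : ∀ k : ℕ, 2 ≤ p * k → c k = 0 := by
    intro k hk2
    set T := ∑' n, E * (((1 / 2 : ℝ)) ^ n) ^ p with hT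
    have hT0 : 0 ≤ T := tsum_nonneg fun n => by positivity
    have key : ∀ N : ℕ, k < N →
        N * ((((2 * Real.exp 1 * D)⁻¹) ^ k) ^ p * ‖c k‖) ≤ M + T := by
      intro N hN
      have hN1 : (1 : ℝ) ≤ N := by exact_mod_cast (by omega : 1 ≤ N)
      have h1 := norm_coeff_le_of_bounded hp0 hhom hf hM hN (r := N * (2 * Real.exp 1 * D)⁻¹)
        (g := fun n => E * (((1 / 2 : ℝ)) ^ n) ^ p) (fun n => by positivity)
        ((summable_rpow_half_pow hp0).mul_left E) (by
          intro n hn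
          rw [norm_smul_pow _ _ _ (by positivity)]
          calc ((N * (2 * Real.exp 1 * D)⁻¹) ^ n) ^ p * ‖c n‖
              ≤ ((N * (2 * Real.exp 1 * D)⁻¹) ^ n) ^ p *
                (E * (R ^ n * ((n.factorial : ℝ)⁻¹) ^ p)) := by gcongr; exact hc n
            _ = E * ((((N : ℝ) / (2 * Real.exp 1)) ^ n / (n.factorial : ℝ)) ^ p) := by
                rw [← hDR, Real.rpow_pow_comm hD.le]
                rw [mul_left_comm, ← mul_assoc (_ ^ p), ← Real.mul_rpow (by positivity)
                  (by positivity), ← Real.mul_rpow (by positivity) (by positivity), ← mul_pow]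
                congr 3
                field_simp
            _ ≤ _ := by
                gcongr
                exact half_pow_bound hn)
      rw [norm_smul_pow _ _ _ (by positivity), mul_pow,
        Real.mul_rpow (by positivity) (by positivity)] at h1
      have h2 : (N : ℝ) ^ 2 ≤ ((N : ℝ) ^ k) ^ p := by
        rw [← Real.rpow_natCast, ← Real.rpow_natCast, ← Real.rpow_mul (by positivity)]
        refine Real.rpow_le_rpow_of_exponent_le hN1 ?_
        push_cast
        linarith
      set s := (((2 * Real.exp 1 * D)⁻¹) ^ k) ^ p * ‖c k‖ with hs
      have hs0 : 0 ≤ s := by positivity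
      have h3 : (N : ℝ) ^ 2 * s ≤ N * M + T := by
        rw [mul_assoc, ← hs] at h1
        exact (mul_le_mul_of_nonneg_right h2 hs0).trans h1
      refine le_of_mul_le_mul_left ?_ (by linarith : (0 : ℝ) < N)
      nlinarith
    have h0 := eq_zero_of_forall_nat_mul_le (by positivity) k key
    rcases mul_eq_zero.1 h0 with h | h
    · exact absurd h (by positivity)
    · exact norm_eq_zero.1 h
  -- The series is now a polynomial: with `d + k + 1` nodes fixed there is no tail, and the radius
  -- `N ^ (1 / p)` can tend to infinity.
  obtain ⟨d, hd⟩ := exists_nat_gt (2 / p)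
  rw [div_lt_iff₀ hp0] at hd
  have hzero : ∀ n, d ≤ n → c n = 0 := fun n hn => hlarge n (by
    have : (d : ℝ) ≤ n := by exact_mod_cast hn
    nlinarith)
  refine norm_eq_zero.1 (eq_zero_of_forall_nat_mul_le (norm_nonneg _) 0
    (C := (d + k + 1 : ℕ) * M) fun N hN => ?_)
  have hN1 : (1 : ℝ) ≤ N := by exact_mod_cast hN
  have h1 := norm_coeff_le_of_bounded hp0 hhom hf hM (N := d + k + 1) (k := k) (by omega)
    (r := (N : ℝ) ^ p⁻¹) (g := fun _ => 0) (fun _ => le_rfl) summable_zero (by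
      intro n hn
      rw [hzero n (by omega), smul_zero, norm_zero])
  rw [norm_smul_pow _ _ _ (by positivity), tsum_zero, add_zero, ← Real.rpow_pow_comm (by positivity),
    Real.rpow_inv_rpow (by positivity) hp0.ne'] at h1
  exact (mul_le_mul_of_nonneg_right (le_self_pow₀ hN1 (by omega)) (norm_nonneg _)).trans h1

end Liouville

/-! ### Exponentials and commutativity. -/

section Commutativity

variable {A : Type*} [NormedRing A] [Algebra ℂ A] {p : ℝ}

/-- The terms of the exponential series. -/
noncomputable def expTerm (x : A) (n : ℕ) : A := ((n.factorial : ℂ)⁻¹) • x ^ n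

theorem norm_expTerm_le (hhom : ∀ (c : ℂ) (a : A), ‖c • a‖ = ‖c‖ ^ p * ‖a‖) (x : A) (n : ℕ) :
    ‖expTerm x n‖ ≤ (1 + ‖(1 : A)‖) * (‖x‖ ^ n * ((n.factorial : ℝ)⁻¹) ^ p) := by
  rw [expTerm, hhom, norm_inv, Complex.norm_natCast]
  calc _ ≤ ((n.factorial : ℝ)⁻¹) ^ p * ((1 + ‖(1 : A)‖) * ‖x‖ ^ n) := by
        gcongr; exact norm_pow_le_one_add_norm_one_mul x n
    _ = _ := by ring

theorem summable_pow_mul_inv_factorial_rpow (hp0 : 0 < p) {R : ℝ} (hR : 0 ≤ R) :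
    Summable fun n : ℕ => R ^ n * ((n.factorial : ℝ)⁻¹) ^ p := by
  set D := R ^ p⁻¹ with hD
  have hD0 : 0 ≤ D := by positivity
  have hDR : D ^ p = R := Real.rpow_inv_rpow hR hp0.ne'
  refine Summable.of_nonneg_of_le (fun n => by positivity) (fun n => ?_)
    ((summable_rpow_half_pow hp0).mul_left ((Real.exp (2 * D)) ^ p))
  rw [← hDR, Real.rpow_pow_comm hD0, ← Real.mul_rpow (by positivity) (by positivity),
    ← Real.mul_rpow (by positivity) (by positivity)]
  refine Real.rpow_le_rpow (by positivity) ?_ hp0.le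
  have := Real.pow_div_factorial_le_exp (x := 2 * D) (by positivity) n
  calc D ^ n * (n.factorial : ℝ)⁻¹ = (2 * D) ^ n / n.factorial * (1 / 2) ^ n := by
        rw [mul_pow, div_pow, one_pow]; field_simp
    _ ≤ _ := by gcongr

theorem summable_norm_expTerm (hp0 : 0 < p) (hhom : ∀ (c : ℂ) (a : A), ‖c • a‖ = ‖c‖ ^ p * ‖a‖)
    (x : A) : Summable fun n => ‖expTerm x n‖ :=
  Summable.of_nonneg_of_le (fun _ => norm_nonneg _) (norm_expTerm_le hhom x)
    ((summable_pow_mul_inv_factorial_rpow hp0 (norm_nonneg x)).mul_left _)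

/-- By the binomial theorem the Cauchy product has terms `(x + (-x)) ^ n / n!`. -/
theorem tsum_expTerm_mul_tsum_expTerm_neg [CompleteSpace A] (hp0 : 0 < p)
    (hhom : ∀ (c : ℂ) (a : A), ‖c • a‖ = ‖c‖ ^ p * ‖a‖) (x : A) :
    (∑' n, expTerm x n) * ∑' n, expTerm (-x) n = 1 := by
  rw [tsum_mul_tsum_eq_tsum_sum_antidiagonal_of_summable_norm (summable_norm_expTerm hp0 hhom x)
    (summable_norm_expTerm hp0 hhom (-x))]
  have key : ∀ n, ∑ kl ∈ antidiagonal n, expTerm x kl.1 * expTerm (-x) kl.2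
      = ((n.factorial : ℂ)⁻¹) • (0 : A) ^ n := by
    intro n
    have h := (Commute.neg_right (Commute.refl x)).add_pow' n
    rw [add_neg_cancel] at h
    rw [h, smul_sum]
    refine sum_congr rfl fun kl hkl => ?_
    rw [expTerm, expTerm, smul_mul_smul_comm, ← Nat.cast_smul_eq_nsmul ℂ, smul_smul]
    congr 1
    rw [← mem_antidiagonal.1 hkl, Nat.cast_add_choose]
    have h1 : ((kl.1 + kl.2).factorial : ℂ) ≠ 0 := by exact_mod_cast Nat.factorial_ne_zero _
    have h2 : ((kl.1).factorial : ℂ) ≠ 0 := by exact_mod_cast Nat.factorial_ne_zero _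
    have h3 : ((kl.2).factorial : ℂ) ≠ 0 := by exact_mod_cast Nat.factorial_ne_zero _
    field_simp
  simp only [key]
  rw [tsum_eq_single 0]
  · simp
  · intro n hn
    simp [hn]

/-- The coefficients of the power series of `z ↦ exp (z a) * b * exp (- z a)`. -/
noncomputable def conjCoeff (a b : A) (n : ℕ) : A :=
  ∑ kl ∈ antidiagonal n, expTerm a kl.1 * (b * expTerm (-a) kl.2)

/-- The `4` combines `1 / (k! l!) ≤ 2 ^ n / n!` with the count `n + 1 ≤ 2 ^ n`; the `+ 1` keeps the
growth rate positive. -/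
theorem norm_conjCoeff_le (hp0 : 0 < p) (hp1 : p ≤ 1)
    (hhom : ∀ (c : ℂ) (a : A), ‖c • a‖ = ‖c‖ ^ p * ‖a‖) (a b : A) (n : ℕ) :
    ‖conjCoeff a b n‖ ≤ (1 + ‖(1 : A)‖) ^ 2 * ‖b‖ *
      ((4 * (‖a‖ + 1)) ^ n * ((n.factorial : ℝ)⁻¹) ^ p) := by
  have hterm : ∀ kl ∈ antidiagonal n, ‖expTerm a kl.1 * (b * expTerm (-a) kl.2)‖ ≤
      (1 + ‖(1 : A)‖) ^ 2 * ‖b‖ * ((2 * (‖a‖ + 1)) ^ n * ((n.factorial : ℝ)⁻¹) ^ p) := by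
    rintro ⟨k, l⟩ hkl
    have hkl' : k + l = n := mem_antidiagonal.1 hkl
    have hfac : ((k.factorial : ℝ)⁻¹) * ((l.factorial : ℝ)⁻¹) ≤ 2 ^ n * (n.factorial : ℝ)⁻¹ := by
      have h1 : ((n.choose k : ℕ) : ℝ) ≤ 2 ^ n := by exact_mod_cast Nat.choose_le_two_pow n k
      have h2 : ((n.choose k : ℕ) : ℝ) * (n.factorial : ℝ)⁻¹
          = ((k.factorial : ℝ)⁻¹) * ((l.factorial : ℝ)⁻¹) := by
        rw [← hkl', Nat.cast_add_choose]
        have h1 : ((k + l).factorial : ℝ) ≠ 0 := by exact_mod_cast Nat.factorial_ne_zero _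
        field_simp
      rw [← h2]
      gcongr
    have h2p : ((2 : ℝ) ^ n) ^ p ≤ 2 ^ n := by
      conv_rhs => rw [← Real.rpow_one ((2 : ℝ) ^ n)]
      exact Real.rpow_le_rpow_of_exponent_le (one_le_pow₀ (by norm_num)) hp1
    calc ‖expTerm a k * (b * expTerm (-a) l)‖
        ≤ ‖expTerm a k‖ * (‖b‖ * ‖expTerm (-a) l‖) := by
          refine (norm_mul_le _ _).trans ?_
          gcongr
          exact norm_mul_le _ _
      _ ≤ ((1 + ‖(1 : A)‖) * (‖a‖ ^ k * ((k.factorial : ℝ)⁻¹) ^ p)) *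
          (‖b‖ * ((1 + ‖(1 : A)‖) * (‖a‖ ^ l * ((l.factorial : ℝ)⁻¹) ^ p))) := by
          gcongr
          · exact norm_expTerm_le hhom a k
          · simpa using norm_expTerm_le hhom (-a) l
      _ = (1 + ‖(1 : A)‖) ^ 2 * ‖b‖ *
          (‖a‖ ^ n * (((k.factorial : ℝ)⁻¹) * ((l.factorial : ℝ)⁻¹)) ^ p) := by
          rw [Real.mul_rpow (by positivity) (by positivity), ← hkl', pow_add]
          ring
      _ ≤ (1 + ‖(1 : A)‖) ^ 2 * ‖b‖ *
          ((‖a‖ + 1) ^ n * (2 ^ n * ((n.factorial : ℝ)⁻¹) ^ p)) := by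
          gcongr
          · linarith
          · refine (Real.rpow_le_rpow (by positivity) hfac hp0.le).trans ?_
            rw [Real.mul_rpow (by positivity) (by positivity)]
            gcongr
      _ = _ := by rw [mul_pow]; ring
  have hcard : ((n : ℝ) + 1) ≤ 2 ^ n := by exact_mod_cast Nat.lt_two_pow_self (n := n)
  refine (norm_sum_le _ _).trans ((sum_le_card_nsmul _ _ _ hterm).trans ?_)
  rw [Nat.card_antidiagonal, nsmul_eq_mul]
  push_cast
  refine (mul_le_mul_of_nonneg_right hcard (by positivity)).trans_eq ?_
  rw [show (4 : ℝ) * (‖a‖ + 1) = 2 * (2 * (‖a‖ + 1)) by ring, mul_pow 2 (2 * (‖a‖ + 1))]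
  ring

theorem expTerm_smul (z : ℂ) (x : A) (n : ℕ) : expTerm (z • x) n = z ^ n • expTerm x n := by
  rw [expTerm, expTerm, smul_pow, smul_comm]

theorem hasSum_conjCoeff [CompleteSpace A] (hp0 : 0 < p) (hhom : ∀ (c : ℂ) (a : A), ‖c • a‖ = ‖c‖ ^ p * ‖a‖)
    (a b : A) (z : ℂ) :
    HasSum (fun n => z ^ n • conjCoeff a b n)
      ((∑' n, expTerm (z • a) n) * b * ∑' n, expTerm (-(z • a)) n) := by
  have h1 := summable_norm_expTerm hp0 hhom (z • a)
  have h2 := summable_norm_expTerm hp0 hhom (-(z • a))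
  have h3 : Summable fun n => ‖b * expTerm (-(z • a)) n‖ :=
    Summable.of_nonneg_of_le (fun _ => norm_nonneg _) (fun n => norm_mul_le _ _) (h2.mul_left ‖b‖)
  have h4 := (summable_norm_sum_mul_antidiagonal_of_summable_norm h1 h3).of_norm.hasSum
  rw [← tsum_mul_tsum_eq_tsum_sum_antidiagonal_of_summable_norm h1 h3,
    h2.of_norm.tsum_mul_left, ← mul_assoc] at h4
  refine h4.congr_fun fun n => ?_
  rw [conjCoeff, smul_sum]
  refine sum_congr rfl fun kl hkl => ?_
  rw [← smul_neg, expTerm_smul, expTerm_smul, mul_smul_comm, smul_mul_smul_comm, ← pow_add,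
    mem_antidiagonal.1 hkl]

/-- A complete `p`-normed algebra with `‖a‖ ^ 2 ≤ m * ‖a ^ 2‖` is commutative. -/
theorem mul_comm_of_norm_sq_le [CompleteSpace A] (hp0 : 0 < p) (hp1 : p ≤ 1)
    (hhom : ∀ (c : ℂ) (a : A), ‖c • a‖ = ‖c‖ ^ p * ‖a‖) {m : ℝ} (hm : 0 < m)
    (hsq : ∀ a : A, ‖a‖ ^ 2 ≤ m * ‖a ^ 2‖) (a b : A) : a * b = b * a := by
  have h := coeff_eq_zero_of_bounded hp0 hhom (hasSum_conjCoeff hp0 hhom a b) (M := m * ‖b‖)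
    (fun z => norm_conj_le hm hsq (by
      simpa using tsum_expTerm_mul_tsum_expTerm_neg hp0 hhom (-(z • a))) b)
    (R := 4 * (‖a‖ + 1)) (by positivity) (by positivity) (norm_conjCoeff_le hp0 hp1 hhom a b)
    (le_refl 1)
  -- The coefficient of degree one is `a * b - b * a`.
  rw [conjCoeff, Nat.antidiagonal_succ] at h
  simp [expTerm] at h
  rw [neg_add_eq_zero] at h
  exact h.symm

end Commutativity

/-! ### The support seminorm as an algebra seminorm. -/

section SupportSeminorm

variable {A : Type*} [SeminormedRing A] {p : ℝ}

/-- Arbitrary finite index types let decompositions be combined over sums and products of types. -/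
theorem supportSeminorm_sum_le {ι : Type*} [Fintype ι] [Nonempty ι] (x : ι → A) :
    supportSeminorm p (∑ i, x i) ≤ ∑ i, ‖x i‖ ^ (1 / p) := by
  refine csInf_le ⟨0, ?_⟩ ⟨Fintype.card ι, x ∘ (Fintype.equivFin ι).symm, Fintype.card_pos, ?_, ?_⟩
  · rintro _ ⟨n, y, -, -, rfl⟩
    positivity
  · exact ((Fintype.equivFin ι).symm.sum_comp x).symm
  · exact ((Fintype.equivFin ι).symm.sum_comp fun i => ‖x i‖ ^ (1 / p)).symm

theorem supportSeminorm_le (a : A) : supportSeminorm p a ≤ ‖a‖ ^ (1 / p) := by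
  simpa using supportSeminorm_sum_le (p := p) fun _ : Unit => a

theorem le_supportSeminorm {a : A} {c : ℝ}
    (h : ∀ (n : ℕ) (x : Fin n → A), 1 ≤ n → a = ∑ i, x i → c ≤ ∑ i, ‖x i‖ ^ (1 / p)) :
    c ≤ supportSeminorm p a := by
  refine le_csInf ⟨_, 1, fun _ => a, le_rfl, by simp, rfl⟩ ?_
  rintro _ ⟨n, x, hn, hx, rfl⟩
  exact h n x hn hx

theorem supportSeminorm_nonneg (a : A) : 0 ≤ supportSeminorm p a :=
  le_supportSeminorm fun _ _ _ _ => by positivity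

theorem le_mul_supportSeminorm {a : A} {c S : ℝ} (hS : 0 ≤ S)
    (h : ∀ (n : ℕ) (x : Fin n → A), 1 ≤ n → a = ∑ i, x i → c ≤ S * ∑ i, ‖x i‖ ^ (1 / p)) :
    c ≤ S * supportSeminorm p a := by
  rcases hS.eq_or_lt with rfl | hS
  · simpa using h 1 (fun _ => a) le_rfl (by simp)
  · rw [← div_le_iff₀' hS]
    refine le_supportSeminorm fun n x hn hx => ?_
    rw [div_le_iff₀' hS]
    exact h n x hn hx

theorem supportSeminorm_add_le (a b : A) :
    supportSeminorm p (a + b) ≤ supportSeminorm p a + supportSeminorm p b := by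
  rw [← sub_le_iff_le_add]
  refine le_supportSeminorm fun n x hn hx => ?_
  rw [sub_le_comm]
  refine le_supportSeminorm fun k y hk hy => ?_
  rw [sub_le_iff_le_add']
  have : Nonempty (Fin n ⊕ Fin k) := ⟨Sum.inl ⟨0, hn⟩⟩
  simpa [Fintype.sum_sum_type, ← hx, ← hy] using supportSeminorm_sum_le (p := p) (Sum.elim x y)

theorem supportSeminorm_mul_le (hp0 : 0 < p) (a b : A) :
    supportSeminorm p (a * b) ≤ supportSeminorm p a * supportSeminorm p b := by
  refine le_mul_supportSeminorm (supportSeminorm_nonneg a) fun k y hk hy => ?_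
  rw [mul_comm]
  refine le_mul_supportSeminorm (by positivity) fun n x hn hx => ?_
  have : Nonempty (Fin n × Fin k) := ⟨⟨0, hn⟩, ⟨0, hk⟩⟩
  have h := supportSeminorm_sum_le (p := p) fun ij : Fin n × Fin k => x ij.1 * y ij.2
  rw [Fintype.sum_prod_type, ← sum_mul_sum, ← hx, ← hy, Fintype.sum_prod_type] at h
  rw [mul_comm, sum_mul_sum]
  refine h.trans (sum_le_sum fun i _ => sum_le_sum fun j _ => ?_)
  rw [← Real.mul_rpow (norm_nonneg _) (norm_nonneg _)]
  exact Real.rpow_le_rpow (norm_nonneg _) (norm_mul_le _ _) (by positivity)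

theorem supportSeminorm_neg (a : A) : supportSeminorm p (-a) = supportSeminorm p a := by
  have key : ∀ b : A, supportSeminorm p (-b) ≤ supportSeminorm p b := fun b =>
    le_supportSeminorm fun n x hn hx => by
      have : Nonempty (Fin n) := ⟨⟨0, hn⟩⟩
      simpa [hx] using supportSeminorm_sum_le (p := p) fun i => -x i
  exact (key a).antisymm (by simpa using key (-a))

theorem supportSeminorm_zero (hp0 : 0 < p) : supportSeminorm p (0 : A) = 0 := by
  refine le_antisymm ?_ (supportSeminorm_nonneg _)
  simpa [hp0.ne'] using supportSeminorm_le (p := p) (0 : A)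

theorem supportSeminorm_smul_le [Algebra ℂ A] (hp0 : 0 < p)
    (hhom : ∀ (c : ℂ) (a : A), ‖c • a‖ = ‖c‖ ^ p * ‖a‖) (c : ℂ) (a : A) :
    supportSeminorm p (c • a) ≤ ‖c‖ * supportSeminorm p a := by
  refine le_mul_supportSeminorm (norm_nonneg c) fun n x hn hx => ?_
  have : Nonempty (Fin n) := ⟨⟨0, hn⟩⟩
  have h := supportSeminorm_sum_le (p := p) fun i => c • x i
  rw [← smul_sum, ← hx] at h
  refine h.trans_eq ?_
  rw [mul_sum]
  refine sum_congr rfl fun i _ => ?_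
  rw [hhom, Real.mul_rpow (by positivity) (norm_nonneg _), ← Real.rpow_mul (norm_nonneg _),
    mul_one_div_cancel hp0.ne', Real.rpow_one]

end SupportSeminorm

/-! ### Lower bound for the support seminorm. -/

section Commutative

variable {A : Type*} [NormedCommRing A] {p m : ℝ}

theorem norm_prod_pow_le {ι : Type*} (s : Finset ι) (x : ι → A) (k : ι → ℕ) :
    ‖∏ i ∈ s, x i ^ k i‖ ≤ ‖(1 : A)‖ * ∏ i ∈ s, ‖x i‖ ^ k i := by
  classical
  have hmul : ∀ (y z : A) (n : ℕ), ‖y ^ n * z‖ ≤ ‖y‖ ^ n * ‖z‖ := by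
    intro y z n
    induction n with
    | zero => simp
    | succ n ih =>
      rw [pow_succ', mul_assoc, pow_succ', mul_assoc]
      exact (norm_mul_le _ _).trans (mul_le_mul_of_nonneg_left ih (norm_nonneg _))
  induction s using Finset.induction_on with
  | empty => simp
  | insert i s hi ih =>
    rw [prod_insert hi, prod_insert hi, mul_left_comm]
    exact (hmul _ _ _).trans (mul_le_mul_of_nonneg_left ih (by positivity))

theorem card_piAntidiag_le {ι : Type*} [Fintype ι] [DecidableEq ι] (n : ℕ) :
    #(piAntidiag (univ : Finset ι) n) ≤ (n + 1) ^ Fintype.card ι := by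
  have h : piAntidiag (univ : Finset ι) n ⊆ Fintype.piFinset fun _ => range (n + 1) := by
    intro k hk
    rw [mem_piAntidiag] at hk
    rw [Fintype.mem_piFinset]
    intro i
    rw [mem_range, Nat.lt_succ_iff, ← hk.1]
    exact single_le_sum (fun _ _ => Nat.zero_le _) (mem_univ i)
  exact (card_le_card h).trans_eq (by simp)

variable [Algebra ℂ A]

theorem norm_natCast_mul (hhom : ∀ (c : ℂ) (a : A), ‖c • a‖ = ‖c‖ ^ p * ‖a‖) (n : ℕ) (a : A) :
    ‖(n : A) * a‖ = (n : ℝ) ^ p * ‖a‖ := by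
  rw [← nsmul_eq_mul, ← Nat.cast_smul_eq_nsmul ℂ, hhom, Complex.norm_natCast]

/-- Each monomial has norm at most `‖1‖` times the `p`-th power of one term in the expansion of `(∑
‖x i‖ ^ (1 / p)) ^ n`, hence of the whole; the number of monomials is polynomial in `n`. -/
theorem norm_sum_pow_le (hp0 : 0 < p) (hhom : ∀ (c : ℂ) (a : A), ‖c • a‖ = ‖c‖ ^ p * ‖a‖)
    {ι : Type*} [Fintype ι] (x : ι → A) (n : ℕ) :
    ‖(∑ i, x i) ^ n‖ ≤
      ‖(1 : A)‖ * ((n : ℝ) + 1) ^ Fintype.card ι * ((∑ i, ‖x i‖ ^ (1 / p)) ^ p) ^ n := by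
  classical
  set T := ∑ i, ‖x i‖ ^ (1 / p) with hT
  have hT0 : 0 ≤ T := by positivity
  rw [sum_pow_eq_sum_piAntidiag]
  refine (norm_sum_le _ _).trans ?_
  refine (sum_le_card_nsmul _ _ (‖(1 : A)‖ * (T ^ p) ^ n) fun k hk => ?_).trans ?_
  · rw [norm_natCast_mul hhom, Real.rpow_pow_comm hT0, hT, sum_pow_eq_sum_piAntidiag]
    have h1 := norm_prod_pow_le univ x k
    have h2 : ∏ i, ‖x i‖ ^ k i = (∏ i, (‖x i‖ ^ (1 / p)) ^ k i) ^ p := by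
      rw [← Real.finsetProd_rpow _ _ fun i _ => by positivity]
      refine prod_congr rfl fun i _ => ?_
      rw [← Real.rpow_pow_comm (by positivity), ← Real.rpow_mul (norm_nonneg _),
        one_div_mul_cancel hp0.ne', Real.rpow_one]
    rw [h2] at h1
    refine (mul_le_mul_of_nonneg_left h1 (by positivity)).trans ?_
    rw [mul_left_comm, ← Real.mul_rpow (by positivity) (by positivity)]
    gcongr
    exact single_le_sum
      (f := fun k : ι → ℕ => (Nat.multinomial univ k : ℝ) * ∏ i, (‖x i‖ ^ (1 / p)) ^ k i)
      (fun k _ => by positivity) hk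
  · rw [nsmul_eq_mul]
    have : ((#(piAntidiag (univ : Finset ι) n) : ℕ) : ℝ) ≤ ((n : ℝ) + 1) ^ Fintype.card ι := by
      exact_mod_cast card_piAntidiag_le n
    refine (mul_le_mul_of_nonneg_right this (by positivity)).trans_eq ?_
    ring

theorem norm_sum_le_of_norm_sq_le (hp0 : 0 < p)
    (hhom : ∀ (c : ℂ) (a : A), ‖c • a‖ = ‖c‖ ^ p * ‖a‖) (hm : 0 < m)
    (hsq : ∀ a : A, ‖a‖ ^ 2 ≤ m * ‖a ^ 2‖) {ι : Type*} [Fintype ι] (x : ι → A) :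
    ‖∑ i, x i‖ ≤ m * (∑ i, ‖x i‖ ^ (1 / p)) ^ p := by
  refine le_of_forall_pow_two_pow_le (C := ‖(1 : A)‖ / m) (Fintype.card ι) (by positivity)
    fun n => ?_
  rw [div_mul_eq_mul_div, div_mul_eq_mul_div, le_div_iff₀ hm, mul_comm _ m]
  refine (norm_pow_two_pow_le hm hsq _ n).trans
    ((mul_le_mul_of_nonneg_left (norm_sum_pow_le hp0 hhom x _) (by positivity)).trans_eq ?_)
  rw [mul_pow]
  ring

theorem rpow_norm_le_supportSeminorm (hp0 : 0 < p)
    (hhom : ∀ (c : ℂ) (a : A), ‖c • a‖ = ‖c‖ ^ p * ‖a‖) (hm : 0 < m)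
    (hsq : ∀ a : A, ‖a‖ ^ 2 ≤ m * ‖a ^ 2‖) (a : A) :
    (‖a‖ / m) ^ (1 / p) ≤ supportSeminorm p a := by
  refine le_supportSeminorm fun n x hn hx => ?_
  have h := norm_sum_le_of_norm_sq_le hp0 hhom hm hsq x
  rw [← hx, ← div_le_iff₀' hm] at h
  refine (Real.rpow_le_rpow (by positivity) h (by positivity)).trans_eq ?_
  rw [← Real.rpow_mul (by positivity), mul_one_div_cancel hp0.ne', Real.rpow_one]

end Commutative

/-! ### Gelfand theory, transported along an isomorphism. -/

section Gelfand

open WeakDual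

/-- Pulling a character back along a continuous algebra isomorphism. -/
noncomputable def WeakDual.CharacterSpace.compAlgEquiv {A B : Type*} [Ring A] [TopologicalSpace A]
    [Algebra ℂ A] [Ring B] [TopologicalSpace B] [Algebra ℂ B] (e : A ≃ₐ[ℂ] B) (he : Continuous e)
    (φ : characterSpace ℂ B) : characterSpace ℂ A :=
  ⟨StrongDual.toWeakDual ((CharacterSpace.toCLM φ).comp ⟨e.toLinearMap, he⟩), by
    rw [CharacterSpace.eq_set_map_one_map_mul]
    refine ⟨?_, fun x y => ?_⟩
    · change φ (e 1) = 1
      simp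
    · change φ (e (x * y)) = φ (e x) * φ (e y)
      simp⟩

theorem WeakDual.CharacterSpace.compAlgEquiv_apply {A B : Type*} [Ring A] [TopologicalSpace A]
    [Algebra ℂ A] [Ring B] [TopologicalSpace B] [Algebra ℂ B] (e : A ≃ₐ[ℂ] B) (he : Continuous e)
    (φ : characterSpace ℂ B) (a : A) : compAlgEquiv e he φ a = φ (e a) := rfl

/-- Multiplicativity and roots of powers remove the operator norm of `φ`, with no normalization of
`‖1‖`. -/
theorem WeakDual.CharacterSpace.norm_apply_le_norm {B : Type*} [NormedRing B] [NormedAlgebra ℂ B]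
    (φ : characterSpace ℂ B) (b : B) : ‖φ b‖ ≤ ‖b‖ := by
  refine le_of_forall_pow_two_pow_le (C := ‖CharacterSpace.toCLM φ‖ * (1 + ‖(1 : B)‖)) 0
    (norm_nonneg _) fun n => ?_
  rw [← norm_pow, ← map_pow, pow_zero, mul_one, mul_assoc]
  exact ((CharacterSpace.toCLM φ).le_opNorm _).trans
    (mul_le_mul_of_nonneg_left (norm_pow_le_one_add_norm_one_mul b _) (norm_nonneg _))

/-- Gelfand's formula along `2 ^ n` bounds the spectral radius below; it is attained in the
spectrum, whose points are character values. -/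
theorem WeakDual.CharacterSpace.exists_forall_pow_le {B : Type*} [NormedCommRing B]
    [NormedAlgebra ℂ B] [CompleteSpace B] [Nontrivial B] (b : B) {t : ℝ} (ht : 0 ≤ t)
    (h : ∀ n : ℕ, t ^ (2 ^ n) ≤ ‖b ^ (2 ^ n)‖) : ∃ φ : characterSpace ℂ B, t ≤ ‖φ b‖ := by
  obtain ⟨z, hz, hzr⟩ := spectrum.exists_nnnorm_eq_spectralRadius b
  obtain ⟨φ, hφ⟩ := CharacterSpace.mem_spectrum_iff_exists.1 hz
  refine ⟨φ, ?_⟩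
  rw [hφ]
  have h1 := (spectrum.pow_norm_pow_one_div_tendsto_nhds_spectralRadius b).comp
    (tendsto_pow_atTop_atTop_of_one_lt (one_lt_two (α := ℕ)))
  have h2 : ENNReal.ofReal t ≤ spectralRadius ℂ b := by
    refine ge_of_tendsto' h1 fun n => ENNReal.ofReal_le_ofReal ?_
    have h3 := Real.rpow_le_rpow (by positivity) (h n) (by positivity : 0 ≤ 1 / ((2 ^ n : ℕ) : ℝ))
    rwa [one_div, Real.pow_rpow_inv_natCast ht (by positivity), ← one_div] at h3
  rw [← hzr, ← enorm_eq_nnnorm, ← ofReal_norm,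
    ENNReal.ofReal_le_ofReal_iff (norm_nonneg _)] at h2
  exact h2

theorem WeakDual.CharacterSpace.compactSpace_of_algEquiv {A B : Type*} [Ring A]
    [TopologicalSpace A] [Algebra ℂ A] [NormedRing B] [NormedAlgebra ℂ B] [CompleteSpace B]
    (e : A ≃ₐ[ℂ] B) (he : Continuous e) (he' : Continuous e.symm) :
    CompactSpace (characterSpace ℂ A) := by
  have hsurj : Function.Surjective (compAlgEquiv e he) := fun φ =>
    ⟨compAlgEquiv e.symm he' φ, by
      ext x
      rw [compAlgEquiv_apply, compAlgEquiv_apply, e.symm_apply_apply]⟩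
  refine hsurj.compactSpace (Continuous.subtype_mk ?_ _)
  refine WeakDual.continuous_of_continuous_eval fun a => ?_
  exact (eval_continuous (e a)).comp continuous_subtype_val

/-- The Gelfand transform of a topological algebra isomorphic to a commutative Banach algebra. -/
theorem gelfandTransform_of_algEquiv {A B : Type*} [Ring A]
    [TopologicalSpace A] [Algebra ℂ A] [NormedCommRing B] [NormedAlgebra ℂ B] [CompleteSpace B]
    (e : A ≃ₐ[ℂ] B) (he : Continuous e) (he' : Continuous e.symm) :
    ∃ _ : CompactSpace (characterSpace ℂ A),
      (∀ a, ‖gelfandTransform ℂ A a‖ ≤ ‖e a‖) ∧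
      ∀ (a : A) (t : ℝ), a ≠ 0 → 0 ≤ t → (∀ n : ℕ, t ^ (2 ^ n) ≤ ‖e (a ^ (2 ^ n))‖) →
        t ≤ ‖gelfandTransform ℂ A a‖ := by
  have hcomp := CharacterSpace.compactSpace_of_algEquiv e he he'
  refine ⟨hcomp, fun a => ?_, fun a t ha ht h => ?_⟩
  · refine (ContinuousMap.norm_le _ (norm_nonneg _)).2 fun φ => ?_
    have := CharacterSpace.norm_apply_le_norm (CharacterSpace.compAlgEquiv e.symm he' φ) (e a)
    rwa [CharacterSpace.compAlgEquiv_apply, e.symm_apply_apply] at this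
  · have : Nontrivial B := ⟨e a, 0, by simpa using ha⟩
    obtain ⟨φ, hφ⟩ := CharacterSpace.exists_forall_pow_le (e a) ht (by simpa using h)
    exact hφ.trans
      ((gelfandTransform ℂ A a).norm_coe_le_norm (CharacterSpace.compAlgEquiv e he φ))

end Gelfand

/-! ### Renorming and the final estimates. -/

section Main

open WeakDual

/-- For commutative `A`, the support seminorm is the norm of a commutative Banach algebra with the
same topology. It is put on a separate copy `B` of `A`, to keep the two norms apart. -/
theorem gelfandTransform_of_supportSeminorm {A : Type*} [NormedCommRing A] [CompleteSpace A]
    [Algebra ℂ A] {p m : ℝ} (hp0 : 0 < p) (hhom : ∀ (c : ℂ) (a : A), ‖c • a‖ = ‖c‖ ^ p * ‖a‖)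
    (hm : 0 < m) (hsq : ∀ a : A, ‖a‖ ^ 2 ≤ m * ‖a ^ 2‖)
    {B : Type*} [CommRing B] [Algebra ℂ B] (e : A ≃ₐ[ℂ] B) :
    ∃ _ : CompactSpace (characterSpace ℂ A),
      (∀ a, ‖gelfandTransform ℂ A a‖ ≤ supportSeminorm p a) ∧
      ∀ a, (‖a‖ / m) ^ (1 / p) ≤ ‖gelfandTransform ℂ A a‖ := by
  have hp : 0 < 1 / p := by positivity
  have hlow := rpow_norm_le_supportSeminorm hp0 hhom hm hsq
  let q : RingNorm B :=
    { toFun := fun b => supportSeminorm p (e.symm b)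
      map_zero' := by rw [map_zero, supportSeminorm_zero hp0]
      add_le' := fun x y => by rw [map_add]; exact supportSeminorm_add_le _ _
      neg' := fun x => by rw [map_neg, supportSeminorm_neg]
      mul_le' := fun x y => by rw [map_mul]; exact supportSeminorm_mul_le hp0 _ _
      eq_zero_of_map_eq_zero' := fun x hx => by
        have h := (hlow (e.symm x)).trans_eq hx
        have h0 : ‖e.symm x‖ / m = 0 := by
          by_contra hne
          have : 0 < ‖e.symm x‖ / m := lt_of_le_of_ne (by positivity) (Ne.symm hne)
          exact absurd h (not_le.2 (Real.rpow_pos_of_pos this _))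
        rw [div_eq_zero_iff, or_iff_left hm.ne', norm_eq_zero] at h0
        simpa using h0 }
  let _ : NormedCommRing B := { q.toNormedRing with mul_comm := mul_comm }
  have hnorm : ∀ a : A, ‖e a‖ = supportSeminorm p a := fun a => by
    change supportSeminorm p (e.symm (e a)) = _
    rw [e.symm_apply_apply]
  let _ : NormedAlgebra ℂ B :=
    { norm_smul_le := fun c b => by
        obtain ⟨a, rfl⟩ := e.surjective b
        rw [← map_smul, hnorm, hnorm]
        exact supportSeminorm_smul_le hp0 hhom c a }
  have he : Continuous e := by
    refine continuous_of_continuousAt_zero e ?_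
    rw [ContinuousAt, map_zero, tendsto_zero_iff_norm_tendsto_zero]
    have h1 : Tendsto (fun a : A => ‖a‖ ^ (1 / p)) (𝓝 0) (𝓝 0) := by
      have := (tendsto_norm_zero (E := A)).rpow_const (p := 1 / p) (Or.inr hp.le)
      rwa [Real.zero_rpow hp.ne'] at this
    exact squeeze_zero (fun _ => norm_nonneg _)
      (fun a => (hnorm a).trans_le (supportSeminorm_le a)) h1
  -- Continuity of the inverse is the estimate `‖a‖ ≤ m * |a| ^ p`.
  have he' : Continuous e.symm := by
    refine continuous_of_continuousAt_zero e.symm ?_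
    rw [ContinuousAt, map_zero, tendsto_zero_iff_norm_tendsto_zero]
    have h1 : Tendsto (fun b : B => m * ‖b‖ ^ p) (𝓝 0) (𝓝 0) := by
      have := ((tendsto_norm_zero (E := B)).rpow_const (p := p) (Or.inr hp0.le)).const_mul m
      rwa [Real.zero_rpow hp0.ne', mul_zero] at this
    refine squeeze_zero (fun _ => norm_nonneg _) (fun b => ?_) h1
    obtain ⟨a, rfl⟩ := e.surjective b
    rw [e.symm_apply_apply, hnorm, ← div_le_iff₀' hm]
    refine (Real.rpow_le_rpow (by positivity) (hlow a) hp0.le).trans' (le_of_eq ?_)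
    rw [← Real.rpow_mul (by positivity), one_div_mul_cancel hp0.ne', Real.rpow_one]
  have hcomplete : CompleteSpace B := by
    let E : A ≃ᵤ B :=
      { e.toEquiv with
        uniformContinuous_toFun := uniformContinuous_addMonoidHom_of_continuous (f := e) he
        uniformContinuous_invFun :=
          uniformContinuous_addMonoidHom_of_continuous (f := e.symm) he' }
    exact E.completeSpace_iff.1 inferInstance
  obtain ⟨hcomp, h1, h2⟩ := gelfandTransform_of_algEquiv e he he'
  refine ⟨hcomp, fun a => (h1 a).trans_eq (hnorm a), fun a => ?_⟩
  rcases eq_or_ne a 0 with rfl | ha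
  · rw [norm_zero, zero_div, Real.zero_rpow hp.ne']
    exact norm_nonneg _
  -- Here `t = (‖a‖ / m) ^ (1 / p)`: the iterated inequality reads `(‖a‖ / m) ^ N ≤ ‖a ^ N‖ / m`,
  -- which matches the lower bound for `|a ^ N|`.
  · refine h2 a _ ha (by positivity) fun n => ?_
    rw [hnorm]
    refine le_trans ?_ (hlow (a ^ 2 ^ n))
    rw [Real.rpow_pow_comm (by positivity)]
    refine Real.rpow_le_rpow (by positivity) ?_ hp.le
    rw [div_pow, div_le_div_iff₀ (by positivity) hm, mul_comm, mul_comm ‖a ^ 2 ^ n‖]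
    exact norm_pow_two_pow_le hm hsq a n

theorem gelfandTransform_bounds {A : Type*} [NormedCommRing A] [CompleteSpace A] [Algebra ℂ A]
    {p : ℝ} (hp0 : 0 < p) (hhom : ∀ (c : ℂ) (a : A), ‖c • a‖ = ‖c‖ ^ p * ‖a‖)
    {m : ℝ} (hm : 0 < m) (hsq : ∀ a : A, ‖a‖ ^ 2 ≤ m * ‖a ^ 2‖) :
    ∃ _ : CompactSpace (characterSpace ℂ A),
      Function.Injective (gelfandTransform ℂ A) ∧
      ∀ a : A,
        m ^ (-(2 / p)) * ‖a‖ ^ (1 / p) ≤ m ^ (-(1 / p)) * supportSeminorm p a ∧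
        m ^ (-(1 / p)) * supportSeminorm p a ≤ ‖gelfandTransform ℂ A a‖ ∧
        ‖gelfandTransform ℂ A a‖ ≤ supportSeminorm p a ∧
        supportSeminorm p a ≤ ‖a‖ ^ (1 / p) := by
  obtain ⟨hcomp, h1, h2⟩ :=
    gelfandTransform_of_supportSeminorm hp0 hhom hm hsq (AlgEquiv.refl (R := ℂ) (A₁ := A))
  have hdiv : ∀ a : A, (‖a‖ / m) ^ (1 / p) = m ^ (-(1 / p)) * ‖a‖ ^ (1 / p) := fun a => by
    rw [Real.div_rpow (norm_nonneg _) hm.le, Real.rpow_neg hm.le, div_eq_inv_mul]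
  refine ⟨hcomp, (injective_iff_map_eq_zero _).2 fun a ha => ?_, fun a => ⟨?_, ?_, h1 a, ?_⟩⟩
  · have h := h2 a
    rw [ha, norm_zero] at h
    by_contra hne
    have : 0 < ‖a‖ / m := div_pos (norm_pos_iff.2 hne) hm
    exact absurd h (not_le.2 (Real.rpow_pos_of_pos this _))
  · rw [show -(2 / p) = -(1 / p) + -(1 / p) by ring, Real.rpow_add hm, mul_assoc, ← hdiv]
    gcongr
    exact rpow_norm_le_supportSeminorm hp0 hhom hm hsq a
  · refine le_trans ?_ (h2 a)
    rw [hdiv]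
    gcongr
    exact supportSeminorm_le a
  · exact supportSeminorm_le a

end Main

/-- A complex unital `p`-Banach algebra is a complete `NormedRing` (a ring with a complete metric
given by a definite, subadditive, submultiplicative `‖·‖`; no condition on `‖1‖`) with a complex
algebra structure for which `‖·‖` is `p`-homogeneous. `WeakDual.characterSpace ℂ A` is the set of
nonzero continuous multiplicative linear functionals with the topology of pointwise convergence,
and `WeakDual.gelfandTransform ℂ A` is the algebra homomorphism `a ↦ (φ ↦ φ a)`. -/
theorem theorem4p3 {A : Type*} [NormedRing A] [CompleteSpace A] [Algebra ℂ A]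
    (p : ℝ) (hp0 : 0 < p) (hp1 : p ≤ 1)
    (hhom : ∀ (c : ℂ) (a : A), ‖c • a‖ = ‖c‖ ^ p * ‖a‖)
    (m : ℝ) (hm : 0 < m) (hsq : ∀ a : A, ‖a‖ ^ 2 ≤ m * ‖a ^ 2‖) :
    ∃ _ : CompactSpace (WeakDual.characterSpace ℂ A),
      Function.Injective (WeakDual.gelfandTransform ℂ A) ∧
      ∀ a : A,
        m ^ (-(2 / p)) * ‖a‖ ^ (1 / p) ≤ m ^ (-(1 / p)) * supportSeminorm p a ∧
        m ^ (-(1 / p)) * supportSeminorm p a ≤ ‖WeakDual.gelfandTransform ℂ A a‖ ∧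
        ‖WeakDual.gelfandTransform ℂ A a‖ ≤ supportSeminorm p a ∧
        supportSeminorm p a ≤ ‖a‖ ^ (1 / p) := by
  let _ : NormedCommRing A :=
    { ‹NormedRing A› with mul_comm := mul_comm_of_norm_sq_le hp0 hp1 hhom hm hsq }
  exact gelfandTransform_bounds (A := A) hp0 hhom hm hsq
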